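/- A deterministic Markov decision process (DMDP) is a finite directed graph $(V,E)$ with a linearly ordered vertex set, in which every vertex has an outgoing edge, together with integer edge weights $w$. Its size is $|V|+|E|+\sum_{e\in E}\lceil\log_2|w(e)|\rceil$, where edges of weight $0$ contribute $0$ to the sum. A (positional) policy $\sigma$ chooses a successor $\sigma(v)$ with $(v,\sigma(v))\in E$ for every vertex $v$. Following $\sigma$ from $v$ gives a run $v=v_0,v_1,\dots$; let $\mathrm{val}^\sigma(v)=\liminf_{t\to\infty}\frac1t\sum_{i<t}w(v_i,v_{i+1})$ be its mean payoff, and let $\mathrm{pot}^\sigma(v)=\sum_{i<p}\bigl(w(v_i,v_{i+1})-\mathrm{val}^\sigma(v)\bigr)$, where $p$ is the first time at which the run reaches the least vertex of the cycle in which it ends. A policy is optimal if from every vertex its mean payoff is the maximum over all policies. The appraisal of an edge $(v,u)$ is the pair $\bigl(\mathrm{val}^\sigma(u),\,w(v,u)-\mathrm{val}^\sigma(u)+\mathrm{pot}^\sigma(u)\bigr)$; appraisals are compared lexicographically. The Bellman operator $\mathcal B$ maps $\sigma$ to the policy that chooses at each $v$ a successor $u$ of maximal appraisal, where ties are resolved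 by first favoring $u=\sigma(v)$, then the least $u$. Howard's policy iteration repeatedly replaces $\sigma$ by $\mathcal B(\sigma)$ and halts as soon as $\mathcal B(\sigma)=\sigma$. Its number of iterations is the number of applications of $\mathcal B$, including the last one, which makes no update. It is started here with the policy that chooses the least successor of every vertex. For a positive integer $n$ let $P_n$ be the DMDP with vertices $t_1<b_1<\dots<b_n<t_2<\dots<t_n$ and the following edges and weights: - $(b_i,b_j)$ for $1\le j<i\le n$ and $(t_i,b_j)$ for $1\le j\le i\le n$, of weight $(n+1)^2$; - $(b_i,t_j)$ for $1\le i,j\le n$ and $(t_i,t_j)$ for $1\le j<i\le n$, of weight $0$; - $(t_i,t_i)$ for $1\le i\le n$, of weight $n(n+1)+i$. **Theorem.** For every $n\ge1$, the DMDP $P_n$ has $2n$ vertices, $\frac{5n^2+n}{2}$ edges and largest absolute weight $(n+1)^2$, and Howard's policy iteration on $P_n$ performs exactly $N_n=\frac{n^2+7n-6}{2}$ iterations and halts with an optimal policy. Moreover, consider the following rules, in which the first applicable case counts: - $\pi_i$: $t_k\mapsto b_k$ for $k\le i-2$; $t_k\mapsto t_k$ for $k\in\{i-1,i\}$; all other vertices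 $\mapsto t_i$; - $\sigma_{i,j}$: $t_i\mapsto t_i$; $t_k\mapsto b_k$ for $k\le j$ or $k\le i-2$; $b_1\mapsto t_i$; $b_k\mapsto b_{k-1}$ for $2\le k\le j$; all other vertices $\mapsto b_j$; - $\tau_i$: $t_k\mapsto t_k$ for $k\in\{i,i+1\}$; $t_k\mapsto b_k$ for $k<i$; $b_1\mapsto t_i$; $b_k\mapsto b_{k-1}$ for $2\le k\le i+2$; all other vertices $\mapsto b_{i+2}$. Then the initial policy is $\pi_1$, and (1) $\mathcal B(\pi_i)=\sigma_{i,1}$ for $1\le i\le n$; (2) $\mathcal B(\sigma_{i,j})=\sigma_{i,j+1}$ for $1\le j\le i<n$, and for $i=n$, $1\le j\le n-2$; (3) $\mathcal B(\sigma_{i,i+1})=\tau_i$ for $1\le i\le n-1$; (4) $\mathcal B(\tau_i)=\pi_{i+1}$ for $1\le i\le n-1$; (5) $\mathcal B(\sigma_{n,n-1})=\sigma_{n,n-1}$ if $n\ge2$. Finally, as $n\to\infty$, the size $I_n$ of $P_n$ is $O(n^2\log n)$, and the number of iterations $N_n$ is $\Omega(n^2)$ and $\Omega(I_n/\log I_n)$,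 hence $\widetilde\Omega(I_n)$. -/

import Mathlib

open Filter Asymptotics

noncomputable section

/-- A deterministic Markov decision process on a finite, linearly ordered set of vertices: a finite
directed weighted graph in which each vertex has an outgoing edge. Only the values of the weight
function on edges are ever used. -/
structure DMDP (V : Type) [Fintype V] [LinearOrder V] where
  /-- the set of edges -/
  E : Finset (V × V)
  exists_edge : ∀ v, ∃ u, (v, u) ∈ E
  /-- the integer weights -/
  w : V → V → ℤ

namespace DMDP

variable {V : Type} [Fintype V] [LinearOrder V]

/-- The set `E(v)` of successors of `v`. -/
def out (P : DMDP V) (v : V) : Finset V := Finset.univ.filter fun u => (v, u) ∈ P.E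

lemma out_nonempty (P : DMDP V) (v : V) : (P.out v).Nonempty := by
  obtain ⟨u, hu⟩ := P.exists_edge v
  exact ⟨u, by simp [out, hu]⟩

/-- The largest absolute weight of an edge. -/
def maxAbsWeight (P : DMDP V) : ℕ := P.E.sup fun e => (P.w e.1 e.2).natAbs

/-- The size `|V| + |E| + ∑ ⌈log₂ |w(e)|⌉`; here `Nat.clog 2 k = ⌈log₂ k⌉` for `k ≥ 1`, and an edge of
weight `0` contributes `0` to the last sum. -/
def size (P : DMDP V) : ℕ :=
  Fintype.card V + P.E.card + ∑ e ∈ P.E, Nat.clog 2 (P.w e.1 e.2).natAbs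

/-- Positional policies. -/
def Policy (P : DMDP V) : Type := {σ : V → V // ∀ v, (v, σ v) ∈ P.E}

/-- The average of the first `t` weights along a sequence of vertices. -/
def avg (P : DMDP V) (ω : ℕ → V) (t : ℕ) : ℝ :=
  (∑ i ∈ Finset.range t, (P.w (ω i) (ω (i + 1)) : ℝ)) / t

/-- The limit-inferior average of a run. (The sequence of averages is bounded, as there are only
finitely many weights.) -/
def limAvg (P : DMDP V) (ω : ℕ → V) : ℝ := liminf (P.avg ω) atTop

namespace Policy

variable {P : DMDP V}

/-- The run from `v` obtained by following `σ`. -/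
def run (σ : P.Policy) (v : V) (k : ℕ) : V := σ.1^[k] v

/-- The mean payoff of `σ` from `v`. -/
def val (σ : P.Policy) (v : V) : ℝ := P.limAvg (σ.run v)

open Classical in
/-- The cycle of the lasso-shaped run from `v`: the vertices that it visits infinitely often. -/
def cycle (σ : P.Policy) (v : V) : Finset V :=
  Finset.univ.filter fun u => ∃ᶠ k in atTop, σ.run v k = u

lemma cycle_nonempty (σ : P.Policy) (v : V) : (σ.cycle v).Nonempty := by
  obtain ⟨u, hu⟩ := Finite.exists_infinite_fiber (σ.run v)
  refine ⟨u, ?_⟩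
  simp only [cycle, Finset.mem_filter, Finset.mem_univ, true_and]
  rw [Nat.frequently_atTop_iff_infinite]
  exact Set.infinite_coe_iff.mp hu

/-- The head of the cycle: its vertex of least index. -/
def head (σ : P.Policy) (v : V) : V := (σ.cycle v).min' (σ.cycle_nonempty v)

lemma exists_run_eq_head (σ : P.Policy) (v : V) : ∃ k, σ.run v k = σ.head v := by
  have h := (σ.cycle v).min'_mem (σ.cycle_nonempty v)
  simp only [cycle, Finset.mem_filter, Finset.mem_univ, true_and] at h
  exact h.exists

/-- The length of the path from `v` to the head of its cycle. -/
def pathLength (σ : P.Policy) (v : V) : ℕ := Nat.find (σ.exists_run_eq_head v)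

/-- The potential of `v`. -/
def pot (σ : P.Policy) (v : V) : ℝ :=
  ∑ i ∈ Finset.range (σ.pathLength v), ((P.w (σ.run v i) (σ.run v (i + 1)) : ℝ) - σ.val v)

/-- `σ` is optimal: from every vertex, its mean payoff is the maximum over all policies. -/
def IsOptimal (σ : P.Policy) : Prop :=
  ∀ v, IsGreatest (Set.range fun σ' : P.Policy => σ'.val v) (σ.val v)

/-- The appraisal of the edge `(v, u)`, in `ℝ × ℝ` with the lexicographic order. -/
def appraisal (σ : P.Policy) (v u : V) : ℝ ×ₗ ℝ :=
  toLex (σ.val u, (P.w v u : ℝ) - σ.val u + σ.pot u)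

/-- The successors of `v` of maximal appraisal. -/
def best (σ : P.Policy) (v : V) : Finset V :=
  (P.out v).filter fun u => ∀ u' ∈ P.out v, σ.appraisal v u' ≤ σ.appraisal v u

lemma best_nonempty (σ : P.Policy) (v : V) : (σ.best v).Nonempty := by
  obtain ⟨u, hu, h⟩ := (P.out v).exists_max_image (σ.appraisal v) (P.out_nonempty v)
  exact ⟨u, Finset.mem_filter.mpr ⟨hu, h⟩⟩

/-- The Bellman operator. Ties are resolved by first favoring `σ v`, then the vertex of least
index. -/
def bellman (σ : P.Policy) : P.Policy :=
  ⟨fun v => if σ.1 v ∈ σ.best v then σ.1 v else (σ.best v).min' (σ.best_nonempty v), by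
    intro v
    dsimp only
    split_ifs with h
    · exact σ.2 v
    · have h' := (Finset.mem_filter.mp ((σ.best v).min'_mem (σ.best_nonempty v))).1
      simpa [out] using h'⟩

/-- `HowardRun σ k τ`: Howard's policy iteration, started with the policy `σ`, performs exactly `k`
iterations and then halts with the policy `τ`. An iteration is one application of the Bellman
operator; the algorithm halts with the first iteration that makes no update, and that iteration is
counted, so that `k` is the number of different policies that appear. -/
inductive HowardRun : P.Policy → ℕ → P.Policy → Prop
  | halt (σ : P.Policy) : σ.bellman = σ → HowardRun σ 1 σ
  | step (σ : P.Policy) (k : ℕ) (τ : P.Policy) :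
      σ.bellman ≠ σ → HowardRun σ.bellman k τ → HowardRun σ (k + 1) τ

end Policy

/-- The policy that maps each vertex to its successor of least index. -/
def initialPolicy (P : DMDP V) : P.Policy :=
  ⟨fun v => (P.out v).min' (P.out_nonempty v), fun v => by
    simpa [out] using (P.out v).min'_mem (P.out_nonempty v)⟩

end DMDP

/-- The names `b₁, b₂, …` and `t₁, t₂, …` of the vertices of the DMDPs below. -/
inductive Label : Type
  | b (k : ℕ)
  | t (k : ℕ)

namespace Label

/-- Sorting key for the order `t₁, b₁, b₂, b₃, …, t₂, t₃, …` (lexicographic in the key). -/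
def key : Label → ℕ ×ₗ ℕ
  | b k => toLex (1, k)
  | t k => if k ≤ 1 then toLex (0, k) else toLex (2, k)

lemma key_injective : Function.Injective key := by
  intro x y h
  rcases x with i | i <;> rcases y with j | j <;> simp only [key] at h <;>
    (try split_ifs at h) <;> simp_all

instance : LinearOrder Label := LinearOrder.lift' key key_injective

/-- The names of the vertices of `P_n`. -/
def names (n : ℕ) : Finset Label := (Finset.Icc 1 n).image b ∪ (Finset.Icc 1 n).image t

/-- The edges, for indices between `1` and `n`. -/
def IsEdge : Label → Label → Prop
  | b i, b j => j < i
  | b _, t _ => True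
  | t i, b j => j ≤ i
  | t i, t j => j ≤ i

instance (x y : Label) : Decidable (IsEdge x y) := by
  rcases x with i | i <;> rcases y with j | j <;> unfold IsEdge <;> infer_instance

/-- The weights of the edges. -/
def weight (n : ℕ) : Label → Label → ℤ
  | b _, b _ => ((n : ℤ) + 1) ^ 2
  | t _, b _ => ((n : ℤ) + 1) ^ 2
  | b _, t _ => 0
  | t i, t j => if i = j then (n : ℤ) * (n + 1) + i else 0

/-- The rule of the policy `π_i`. -/
def piRule (i : ℕ) : Label → Label
  | t k => if k + 2 ≤ i then b k else if k + 1 = i ∨ k = i then t k else t i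
  | b _ => t i

/-- The rule of the policy `σ_{i,j}`. -/
def sigmaRule (i j : ℕ) : Label → Label
  | t k => if k = i then t i else if k ≤ j ∨ k + 2 ≤ i then b k else b j
  | b k => if k = 1 then t i else if k ≤ j then b (k - 1) else b j

/-- The rule of the policy `τ_i`. -/
def tauRule (i : ℕ) : Label → Label
  | t k => if k = i ∨ k = i + 1 then t k else if k < i then b k else b (i + 2)
  | b k => if k = 1 then t i else if k ≤ i + 2 then b (k - 1) else b (i + 2)

end Label

/-- The vertices `b₁, …, b_n, t₁, …, t_n`, ordered as `t₁, b₁, …, b_n, t₂, …, t_n`. -/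
abbrev Vertex (n : ℕ) : Type := {x : Label // x ∈ Label.names n}

/-- The DMDP `P_n`. -/
def howardDMDP (n : ℕ) : DMDP (Vertex n) where
  E := Finset.univ.filter fun e => Label.IsEdge e.1.1 e.2.1
  exists_edge := by
    rintro ⟨x, hx⟩
    have h1 : Label.t 1 ∈ Label.names n := by
      simp only [Label.names, Finset.mem_union, Finset.mem_image, Finset.mem_Icc] at hx ⊢
      rcases hx with ⟨k, hk, -⟩ | ⟨k, hk, -⟩ <;> exact Or.inr ⟨1, ⟨le_rfl, hk.1.trans hk.2⟩, rfl⟩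
    refine ⟨⟨Label.t 1, h1⟩, ?_⟩
    simp only [Label.names, Finset.mem_union, Finset.mem_image, Finset.mem_Icc] at hx
    rcases hx with ⟨k, hk, rfl⟩ | ⟨k, hk, rfl⟩
    · exact Finset.mem_filter.mpr ⟨Finset.mem_univ _, trivial⟩
    · exact Finset.mem_filter.mpr ⟨Finset.mem_univ _, hk.1⟩
  w v u := Label.weight n v.1 u.1

/-- The policy `σ` of `P_n` is the one given by the rule `f`. -/
def Follows {n : ℕ} (σ : (howardDMDP n).Policy) (f : Label → Label) : Prop :=
  ∀ v : Vertex n, (σ.1 v).1 = f v.1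

end

/-! Every policy that occurs has only loops `t_i` as cycles, so its values and potentials are
determined by local equations, and each Bellman step becomes a finite comparison of integers. Phase
`i` begins at `π_i`, once almost every vertex heads for the loop at `t_i`, of weight `n(n+1)+i`.
Relative to this value a heavy edge gains `n+1-i > 0`, so vertices prefer long detours through `b_j,
…, b_1`. Since `b_{j+1}, b_{j+2}, …` all lead to `b_j`, they have equal potential; the least one
wins the tie, and the detour grows by only one vertex per iteration. For `k > i` the loop at `t_k`
gains only `k-i`, so it loses as long as `t_k` can lengthen its detour. It wins first for `k = i+1`,
when `t_{i+1}` already uses `b_{i+1}`: this is `τ_i`. The new loop has a larger value, which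
overrides all potentials: every vertex with an edge to `t_{i+1}` takes it, the detour is destroyed,
and phase `i+1` begins at `π_{i+1}`. Phase `i < n` consists of `π_i`, `σ_{i,1}, …, σ_{i,i+1}`,
`τ_i`, which are `i+3` policies, and phase `n` of `π_n`, `σ_{n,1}, …, σ_{n,n-1}`, which are `n`. The
sum is `N_n`. The steps are carried by `val_pot_of_equations`, `Follows.bellman` and the lemmas
`evaluates_*` and `improves_*`. -/

namespace DMDP

variable {V : Type} [Fintype V] [LinearOrder V] {P : DMDP V}

/-! ### Values and potentials in an arbitrary DMDP -/

lemma limAvg_of_eventually_eq {ω : ℕ → V} {u : V} (h : ∀ᶠ k in atTop, ω k = u) :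
    P.limAvg ω = P.w u u := by
  have h1 : Tendsto (fun i => (P.w (ω i) (ω (i + 1)) : ℝ)) atTop (nhds (P.w u u : ℝ)) := by
    refine tendsto_const_nhds.congr' ?_
    filter_upwards [h, (tendsto_add_atTop_nat 1).eventually h] with k hk hk'
    rw [hk, hk']
  refine Tendsto.liminf_eq (h1.cesaro.congr fun t => ?_)
  rw [avg, div_eq_inv_mul]

/-- The potential differences telescope, and `h` is bounded on the finite vertex set, so the average
exceeds `g` by at most `2C/t`. -/
lemma limAvg_le_of_potential {ω : ℕ → V} {g : ℝ} (h : V → ℝ)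
    (hω : ∀ k, (P.w (ω k) (ω (k + 1)) : ℝ) + h (ω (k + 1)) ≤ g + h (ω k)) :
    P.limAvg ω ≤ g := by
  obtain ⟨C, hC⟩ : ∃ C : ℝ, ∀ v, |h v| ≤ C := by
    obtain ⟨C, hC⟩ := (Set.finite_range fun v => |h v|).bddAbove
    exact ⟨C, fun v => hC ⟨v, rfl⟩⟩
  have hsum : ∀ t : ℕ, ∑ i ∈ Finset.range t, (P.w (ω i) (ω (i + 1)) : ℝ) ≤
      t * g + h (ω 0) - h (ω t) := by
    intro t
    induction t with
    | zero => simp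
    | succ t ih =>
      rw [Finset.sum_range_succ]
      push_cast
      linarith [hω t]
  have hlim : Tendsto (fun t : ℕ => g + 2 * C / (t : ℝ)) atTop (nhds g) := by
    simpa using tendsto_const_nhds.add (tendsto_const_div_atTop_nhds_zero_nat (2 * C))
  have hle : P.avg ω ≤ᶠ[atTop] fun t : ℕ => g + 2 * C / (t : ℝ) := by
    filter_upwards [eventually_gt_atTop 0] with t ht
    have ht' : (0 : ℝ) < t := by exact_mod_cast ht
    rw [avg, div_le_iff₀ ht', add_mul, div_mul_cancel₀ _ ht'.ne']
    linarith [hsum t, (abs_le.1 (hC (ω 0))).2, (abs_le.1 (hC (ω t))).1]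
  -- Monotonicity of a real `liminf` requires a lower bound on the averages.
  have hbdd : IsBoundedUnder (· ≥ ·) atTop (P.avg ω) := by
    obtain ⟨W, hW⟩ : ∃ W : ℝ, ∀ e : V × V, |(P.w e.1 e.2 : ℝ)| ≤ W := by
      obtain ⟨W, hW⟩ := (Set.finite_range fun e : V × V => |(P.w e.1 e.2 : ℝ)|).bddAbove
      exact ⟨W, fun v => hW ⟨v, rfl⟩⟩
    refine isBoundedUnder_of_eventually_ge (a := -W) ?_
    filter_upwards [eventually_gt_atTop 0] with t ht
    have ht' : (0 : ℝ) < t := by exact_mod_cast ht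
    rw [avg, le_div_iff₀ ht']
    have := Finset.card_nsmul_le_sum (Finset.range t)
      (fun i => (P.w (ω i) (ω (i + 1)) : ℝ)) (-W) fun i _ => (abs_le.1 (hW (ω i, ω (i + 1)))).1
    rw [Finset.card_range, nsmul_eq_mul] at this
    linarith
  rw [limAvg, ← hlim.liminf_eq]
  exact liminf_le_liminf hle hbdd hlim.isCoboundedUnder_ge

namespace Policy

variable {σ : P.Policy}

lemma run_succ (σ : P.Policy) (v : V) (k : ℕ) : σ.run v (k + 1) = σ.run (σ.1 v) k :=
  Function.iterate_succ_apply _ _ _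

lemma run_of_fixed {v : V} (h : σ.1 v = v) (k : ℕ) : σ.run v k = v :=
  Function.iterate_fixed h k

lemma eventually_run_of_succ {v u : V} (h : ∀ᶠ k in atTop, σ.run (σ.1 v) k = u) :
    ∀ᶠ k in atTop, σ.run v k = u := by
  obtain ⟨K, hK⟩ := eventually_atTop.1 h
  refine eventually_atTop.2 ⟨K + 1, fun k hk => ?_⟩
  obtain ⟨m, rfl⟩ : ∃ m, k = m + 1 := ⟨k - 1, by omega⟩
  rw [run_succ]
  exact hK m (by omega)

lemma head_of_eventually {v u : V} (h : ∀ᶠ k in atTop, σ.run v k = u) : σ.head v = u := by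
  have : σ.cycle v = {u} := by
    ext x
    simp only [cycle, Finset.mem_filter, Finset.mem_univ, true_and, Finset.mem_singleton]
    constructor
    · intro hx
      obtain ⟨k, hk, hk'⟩ := (hx.and_eventually h).exists
      exact hk.symm.trans hk'
    · rintro rfl
      exact h.frequently
  simp [head, this]

lemma pot_of_head_eq {v : V} (h : σ.head v = v) : σ.pot v = 0 := by
  have : σ.pathLength v = 0 := by
    rw [pathLength, Nat.find_eq_zero]
    exact h.symm
  simp [pot, this]

lemma pot_of_head_ne {v : V} (h : σ.head v ≠ v) (hh : σ.head (σ.1 v) = σ.head v)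
    (hv : σ.val (σ.1 v) = σ.val v) :
    σ.pot v = P.w v (σ.1 v) - σ.val v + σ.pot (σ.1 v) := by
  have hl : σ.pathLength v = σ.pathLength (σ.1 v) + 1 := by
    rw [pathLength, Nat.find_eq_iff]
    refine ⟨?_, fun m hm => ?_⟩
    · rw [run_succ, ← hh]
      exact Nat.find_spec (σ.exists_run_eq_head (σ.1 v))
    · rcases m with _ | m
      · exact fun h' => h h'.symm
      · rw [run_succ, ← hh]
        exact Nat.find_min (σ.exists_run_eq_head (σ.1 v)) (by unfold pathLength at hm; omega)
  rw [pot, hl, Finset.sum_range_succ', pot, hv, add_comm]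
  simp only [run_succ]
  rfl

/-- Values and potentials of a policy all of whose cycles are loops, from the local equations that
determine them. The function `r` decreases along every edge of the policy that is not a loop. -/
theorem val_pot_of_equations (g h : V → ℝ) (r : V → ℕ)
    (H : ∀ v, (σ.1 v = v ∧ g v = P.w v v ∧ h v = 0) ∨
      (r (σ.1 v) < r v ∧ g v = g (σ.1 v) ∧ h v = P.w v (σ.1 v) - g v + h (σ.1 v))) (v : V) :
    σ.val v = g v ∧ σ.pot v = h v := by
  -- For the induction, the loop that the run ends in must be known: `v` and its successor share it,
  -- hence share value and head.
  suffices ∃ u, σ.1 u = u ∧ (∀ᶠ k in atTop, σ.run v k = u) ∧ g v = P.w u u ∧ σ.pot v = h v by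
    obtain ⟨u, -, hu, hg, hp⟩ := this
    exact ⟨(limAvg_of_eventually_eq hu).trans hg.symm, hp⟩
  induction hr : r v using Nat.strong_induction_on generalizing v with
  | _ m ih =>
    rcases H v with ⟨h1, h2, h3⟩ | ⟨h1, h2, h3⟩
    · have hev : ∀ᶠ k in atTop, σ.run v k = v := Eventually.of_forall (run_of_fixed h1)
      exact ⟨v, h1, hev, h2, by rw [h3, pot_of_head_eq (head_of_eventually hev)]⟩
    · obtain ⟨u, hu, hev, hg, hp⟩ := ih _ (hr ▸ h1) (σ.1 v) rfl
      have hev' := eventually_run_of_succ hev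
      have hval : σ.val v = g v := by
        rw [h2, hg]
        exact limAvg_of_eventually_eq hev'
      have hval' : σ.val (σ.1 v) = g v := by
        rw [h2, hg]
        exact limAvg_of_eventually_eq hev
      refine ⟨u, hu, hev', h2.trans hg, ?_⟩
      rw [pot_of_head_ne _ ((head_of_eventually hev).trans (head_of_eventually hev').symm)
        (hval'.trans hval.symm), h3, hp, hval]
      rw [head_of_eventually hev']
      rintro rfl
      rw [hu] at h1
      exact lt_irrefl _ h1

lemma bellman_apply_eq {v u : V} (hu : u ∈ P.out v)
    (hmax : ∀ x ∈ P.out v, σ.appraisal v x ≤ σ.appraisal v u)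
    (htie : u = σ.1 v ∨
      ∀ x ∈ P.out v, σ.appraisal v x = σ.appraisal v u → x ≠ σ.1 v ∧ u ≤ x) :
    σ.bellman.1 v = u := by
  have hub : u ∈ σ.best v := Finset.mem_filter.2 ⟨hu, hmax⟩
  have htop : ∀ x ∈ σ.best v, x ∈ P.out v ∧ σ.appraisal v x = σ.appraisal v u := fun x hx =>
    ⟨(Finset.mem_filter.1 hx).1,
      le_antisymm (hmax x (Finset.mem_filter.1 hx).1) ((Finset.mem_filter.1 hx).2 u hu)⟩
  simp only [bellman]
  rcases htie with rfl | htie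
  · rw [if_pos hub]
  · rw [if_neg fun h => (htie _ (htop _ h).1 (htop _ h).2).1 rfl]
    refine le_antisymm (Finset.min'_le _ _ hub) (Finset.le_min' _ _ _ fun x hx => ?_)
    exact (htie x (htop x hx).1 (htop x hx).2).2

end Policy

end DMDP

/-! ### Integer certificates for Bellman steps -/

/-- In the DMDP `P_n`, the rule `f` determines the values `G` and the potentials `H`, as witnessed by
a rank function `r`. -/
structure Label.Evaluates (n : ℕ) (f : Label → Label) (G H : Label → ℤ) (r : Label → ℕ) :
    Prop where
  out : ∀ x ∈ Label.names n, (f x = x ∧ G x = Label.weight n x x ∧ H x = 0) ∨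
    (r (f x) < r x ∧ G x = G (f x) ∧ H x = Label.weight n x (f x) - G x + H (f x))

/-- The rule `f'` is the best response to the rule `f` with values `G` and potentials `H`. -/
structure Label.Improves (n : ℕ) (f f' : Label → Label) (G H : Label → ℤ) : Prop where
  mem : ∀ x ∈ Label.names n, f' x ∈ Label.names n
  edge : ∀ x ∈ Label.names n, Label.IsEdge x (f' x)
  best : ∀ x ∈ Label.names n, ∀ y ∈ Label.names n, Label.IsEdge x y →
    G y < G (f' x) ∨ G y = G (f' x) ∧
      (Label.weight n x y + H y < Label.weight n x (f' x) + H (f' x) ∨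
        Label.weight n x y + H y = Label.weight n x (f' x) + H (f' x) ∧
          (f' x = f x ∨ y ≠ f x ∧ (f' x).key ≤ y.key))

theorem Follows.val_pot {n : ℕ} {ρ : (howardDMDP n).Policy} {f : Label → Label}
    (hρ : Follows ρ f) {G H : Label → ℤ} {r : Label → ℕ} (hE : Label.Evaluates n f G H r)
    (v : Vertex n) : ρ.val v = G v.1 ∧ ρ.pot v = H v.1 := by
  refine DMDP.Policy.val_pot_of_equations (fun v => (G v.1 : ℝ)) (fun v => (H v.1 : ℝ))
    (fun v => r v.1) (fun v => ?_) v
  rw [hρ v]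
  rcases hE.out v.1 v.2 with ⟨h1, h2, h3⟩ | ⟨h1, h2, h3⟩
  · refine Or.inl ⟨Subtype.ext ((hρ v).trans h1), ?_, ?_⟩
    · rw [h2]; rfl
    · rw [h3]; simp
  · refine Or.inr ⟨h1, by rw [h2], ?_⟩
    rw [h3, ← hρ v]
    push_cast
    rfl

theorem Follows.bellman {n : ℕ} {ρ : (howardDMDP n).Policy} {f f' : Label → Label}
    (hρ : Follows ρ f) {G H : Label → ℤ} {r : Label → ℕ} (hE : Label.Evaluates n f G H r)
    (hI : Label.Improves n f f' G H) : Follows ρ.bellman f' := by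
  intro v
  have hmem := hI.mem v.1 v.2
  have happ : ∀ u : Vertex n, ρ.appraisal v u =
      toLex ((G u.1 : ℝ), ((Label.weight n v.1 u.1 - G u.1 + H u.1 : ℤ) : ℝ)) := by
    intro u
    rw [DMDP.Policy.appraisal, (hρ.val_pot hE u).1, (hρ.val_pot hE u).2]
    push_cast
    rfl
  have hout : ∀ u : Vertex n, u ∈ (howardDMDP n).out v ↔ Label.IsEdge v.1 u.1 := by
    intro u
    simp [DMDP.out, howardDMDP]
  suffices ρ.bellman.1 v = ⟨f' v.1, hmem⟩ by rw [this]
  apply DMDP.Policy.bellman_apply_eq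
  · rw [hout]
    exact hI.edge v.1 v.2
  · intro x hx
    rw [happ, happ, Prod.Lex.toLex_le_toLex]
    dsimp only
    norm_cast
    rcases hI.best v.1 v.2 x.1 x.2 ((hout x).1 hx) with h | ⟨h, h' | ⟨h', -⟩⟩
    · exact Or.inl h
    · exact Or.inr ⟨h, by omega⟩
    · exact Or.inr ⟨h, by omega⟩
  · by_cases hfix : f' v.1 = f v.1
    · exact Or.inl (Subtype.ext (hfix.trans (hρ v).symm))
    · refine Or.inr fun x hx heq => ?_
      rw [happ, happ, toLex_inj, Prod.mk.injEq] at heq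
      norm_cast at heq
      dsimp only at heq
      rcases hI.best v.1 v.2 x.1 x.2 ((hout x).1 hx) with h | ⟨h, h' | ⟨h', h'' | h''⟩⟩
      · omega
      · omega
      · exact absurd h'' hfix
      · refine ⟨fun hx' => h''.1 ?_, h''.2⟩
        rw [hx', hρ v]

/-! ### Weights, and potentials along the chain -/

namespace Label

@[simp] lemma b_mem_names {n k : ℕ} : b k ∈ names n ↔ 1 ≤ k ∧ k ≤ n := by simp [names]

@[simp] lemma t_mem_names {n k : ℕ} : t k ∈ names n ↔ 1 ≤ k ∧ k ≤ n := by simp [names]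

@[simp] lemma key_b_le_key_b {k l : ℕ} : (b k).key ≤ (b l).key ↔ k ≤ l := by
  simp [key, Prod.Lex.toLex_le_toLex]

-- Expanding `(n+1)²` leaves `n(n+1)` as the only product, an atom for `omega`.
@[simp] lemma weight_b_b {n k l : ℕ} : weight n (b k) (b l) = n * (n + 1) + (n + 1) := by
  simp only [weight]; ring

@[simp] lemma weight_t_b {n k l : ℕ} : weight n (t k) (b l) = n * (n + 1) + (n + 1) := by
  simp only [weight]; ring

@[simp] lemma weight_b_t {n k l : ℕ} : weight n (b k) (t l) = 0 := rfl

@[simp] lemma weight_t_t {n k l : ℕ} :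
    weight n (t k) (t l) = if k = l then (n : ℤ) * (n + 1) + k else 0 := rfl

/-- Ranks along the run of a rule whose fixed points are the `t_k` with `p k`. -/
def rank (n : ℕ) (p : ℕ → Prop) [DecidablePred p] : Label → ℕ
  | b k => k
  | t k => if p k then 0 else n + 1

/-- The potential of `b_k` under a rule that leads from `b_k`, `k ≤ j`, through `b_{k-1}, …, b_1` to
the loop at `t_i`, and from all later `b_k` to `b_j`. -/
def chain (n i j k : ℕ) : ℤ :=
  -(n * (n + 1) + i) + (min (k - 1) j : ℕ) * ((n : ℤ) + 1 - i)

lemma chain_one (n i j : ℕ) : chain n i j 1 = -((n : ℤ) * (n + 1) + i) := by simp [chain]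

lemma chain_succ {n i j k : ℕ} (hk : 1 ≤ k) (hkj : k ≤ j) :
    chain n i j (k + 1) = chain n i j k + ((n : ℤ) + 1 - i) := by
  obtain ⟨m, rfl⟩ : ∃ m, k = m + 1 := ⟨k - 1, by omega⟩
  simp only [chain, Nat.add_sub_cancel]
  rw [min_eq_left hkj, min_eq_left (by omega)]
  push_cast
  ring

lemma chain_pred {n i j k : ℕ} (hk : 2 ≤ k) (hkj : k ≤ j + 1) :
    chain n i j k = chain n i j (k - 1) + ((n : ℤ) + 1 - i) := by
  obtain ⟨m, rfl⟩ : ∃ m, k = m + 1 := ⟨k - 1, by omega⟩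
  exact chain_succ (by omega) (by omega)

lemma chain_of_lt {n i j k : ℕ} (hk : j < k) : chain n i j k = chain n i j (j + 1) := by
  simp only [chain, Nat.add_sub_cancel]
  rw [min_eq_right (by omega), min_self]

lemma chain_mono {n i j k l : ℕ} (hi : i ≤ n) (hkl : k ≤ l) :
    chain n i j k ≤ chain n i j l := by
  have : ((min (k - 1) j : ℕ) : ℤ) ≤ (min (l - 1) j : ℕ) := by
    exact_mod_cast min_le_min (by omega) le_rfl
  have := mul_le_mul_of_nonneg_right this (show (0 : ℤ) ≤ n + 1 - i by omega)
  unfold chain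
  linarith

lemma chain_le {n i j : ℕ} (hi : i ≤ n) (k : ℕ) : chain n i j k ≤ chain n i j (j + 1) := by
  rcases le_or_gt k (j + 1) with h | h
  · exact chain_mono hi h
  · exact (chain_of_lt (by omega)).le

/-- The left side is what `t_i` would gain by leaving its loop for `b_k`, and bounds the potential
of a `t_k` that uses `b_k`. So long as it is nonpositive, `t_i` keeps its loop and `b_1` keeps
`t_i`. This is why heavy edges are only slightly heavier than loops. -/
lemma chain_add_nonpos {n i k : ℕ} (j : ℕ) (hi : 1 ≤ i) (hin : i ≤ n) (hk : 1 ≤ k)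
    (h : k ≤ i + 1 ∨ k = i + 2 ∧ i < n) : chain n i j k + ((n : ℤ) + 1 - i) ≤ 0 := by
  obtain ⟨m, rfl⟩ := Nat.exists_eq_add_of_le hin
  have h1 : ((min (k - 1) j : ℕ) : ℤ) ≤ k - 1 := by omega
  have h2 := mul_le_mul_of_nonneg_right h1 (show (0 : ℤ) ≤ m + 1 by positivity)
  have h3 : (k : ℤ) * (m + 1) ≤ (i + m) * (i + m + 1) + i := by
    rcases h with h | ⟨rfl, h⟩
    · have := mul_le_mul_of_nonneg_right (show (k : ℤ) ≤ i + 1 by omega)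
        (show (0 : ℤ) ≤ m + 1 by positivity)
      nlinarith
    · have : (1 : ℤ) ≤ m := by omega
      have : (1 : ℤ) ≤ i := by omega
      push_cast
      nlinarith
  simp only [chain]
  push_cast at h2 ⊢
  rw [show (i : ℤ) + m + 1 - i = m + 1 by ring]
  linarith

/-- Values under `π_i`. -/
def piVal (n i : ℕ) : Label → ℤ
  | t k => if k + 1 = i then n * (n + 1) + k else n * (n + 1) + i
  | b _ => n * (n + 1) + i

/-- Potentials under `π_i`. -/
def piPot (n i : ℕ) : Label → ℤ
  | t k => if k + 1 = i ∨ k = i then 0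
      else if k + 2 ≤ i then (n + 1 - i) - (n * (n + 1) + i) else -(n * (n + 1) + i)
  | b _ => -(n * (n + 1) + i)

/-- Potentials under `σ_{i,j}`. -/
def sigmaPot (n i j : ℕ) : Label → ℤ
  | t k => if k = i then 0
      else if k ≤ j ∨ k + 2 ≤ i then (n + 1 - i) + chain n i j k else chain n i j (j + 1)
  | b k => chain n i j k

/-- Values under `τ_i`. -/
def tauVal (n i : ℕ) : Label → ℤ
  | t k => if k = i + 1 then n * (n + 1) + k else n * (n + 1) + i
  | b _ => n * (n + 1) + i

/-- Potentials under `τ_i`. -/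
def tauPot (n i : ℕ) : Label → ℤ
  | t k => if k = i ∨ k = i + 1 then 0
      else if k < i then (n + 1 - i) + chain n i (i + 2) k else chain n i (i + 2) (i + 3)
  | b k => chain n i (i + 2) k

/-! ### Values and potentials of the policies -/

lemma evaluates_pi (n i : ℕ) :
    Evaluates n (piRule i) (piVal n i) (piPot n i) (rank n fun k => k + 1 = i ∨ k = i) := by
  refine ⟨?_⟩
  rintro (k | k) hk
  · simp only [b_mem_names] at hk
    right
    simp [piRule, piVal, piPot, rank]
    omega
  · simp only [t_mem_names] at hk
    by_cases h : k + 1 = i ∨ k = i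
    · left
      have : ¬ k + 2 ≤ i := by omega
      simp [piRule, piVal, piPot, h, this]
      omega
    · right
      by_cases h' : k + 2 ≤ i
      · simp [piRule, piVal, piPot, rank, h, h']
        omega
      · simp [piRule, piVal, piPot, rank, h, h']
        omega

lemma evaluates_sigma {n i j : ℕ} (hj : 1 ≤ j) (hjn : j ≤ n) :
    Evaluates n (sigmaRule i j) (fun _ => n * (n + 1) + i) (sigmaPot n i j)
      (rank n fun k => k = i) := by
  refine ⟨?_⟩
  have hs := chain_succ (n := n) (i := i) hj le_rfl
  rintro (k | k) hk
  · simp only [b_mem_names] at hk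
    right
    by_cases h : k = 1
    · subst h
      simp [sigmaRule, sigmaPot, rank, chain_one]
    · by_cases h' : k ≤ j
      · have := chain_pred (n := n) (i := i) (j := j) (k := k) (by omega) (by omega)
        simp [sigmaRule, sigmaPot, rank, h, h']
        omega
      · have := chain_of_lt (n := n) (i := i) (j := j) (k := k) (by omega)
        simp [sigmaRule, sigmaPot, rank, h, h']
        omega
  · simp only [t_mem_names] at hk
    by_cases h : k = i
    · left
      simp [sigmaRule, sigmaPot, h]
    · right
      by_cases h' : k ≤ j ∨ k + 2 ≤ i
      · simp [sigmaRule, sigmaPot, rank, h, h']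
        omega
      · simp [sigmaRule, sigmaPot, rank, h, h']
        omega

lemma evaluates_tau {n i : ℕ} (hi : 1 ≤ i) (hin : i < n) :
    Evaluates n (tauRule i) (tauVal n i) (tauPot n i) (rank n fun k => k = i ∨ k = i + 1) := by
  refine ⟨?_⟩
  have hs : chain n i (i + 2) (i + 3) = chain n i (i + 2) (i + 2) + _ :=
    chain_succ (by omega) le_rfl
  rintro (k | k) hk
  · simp only [b_mem_names] at hk
    right
    by_cases h : k = 1
    · subst h
      simp [tauRule, tauVal, tauPot, rank, chain_one]
    · by_cases h' : k ≤ i + 2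
      · have := chain_pred (n := n) (i := i) (j := i + 2) (k := k) (by omega) (by omega)
        simp [tauRule, tauVal, tauPot, rank, h, h']
        omega
      · have : chain n i (i + 2) k = chain n i (i + 2) (i + 3) := chain_of_lt (by omega)
        simp [tauRule, tauVal, tauPot, rank, h, h']
        omega
  · simp only [t_mem_names] at hk
    by_cases h : k = i ∨ k = i + 1
    · left
      simp [tauRule, tauVal, tauPot, h]
      omega
    · right
      by_cases h' : k < i
      · simp [tauRule, tauVal, tauPot, rank, h, h']
        split_ifs <;> omega
      · simp [tauRule, tauVal, tauPot, rank, h, h']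
        split_ifs <;> omega

/-! ### Best responses -/

lemma improves_pi {n i : ℕ} (hi : 1 ≤ i) (hin : i ≤ n) :
    Improves n (piRule i) (sigmaRule i 1) (piVal n i) (piPot n i) := by
  have hn : 2 * (n : ℤ) ≤ n * (n + 1) := by nlinarith [show (1 : ℤ) ≤ n by omega]
  refine ⟨?_, ?_, ?_⟩
  · rintro (k | k) hk <;> simp at hk <;> simp only [sigmaRule] <;> split_ifs <;> simp <;> omega
  · rintro (k | k) hk <;> simp at hk <;> simp only [sigmaRule] <;> split_ifs <;>
      simp [IsEdge] <;> omega
  · rintro (k | k) hk (l | l) hl he <;> simp at hk hl <;> simp only [IsEdge] at he <;>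
      simp only [sigmaRule, piRule] <;> split_ifs <;> simp [piVal, piPot] <;>
      (try split_ifs) <;> omega

/-- For `i = n` the range includes `j = n-1`: the response `σ_{n,n}` is then the same policy on
`P_n`, which gives the halting condition. -/
lemma improves_sigma {n i j : ℕ} (hi : 1 ≤ i) (hj : 1 ≤ j)
    (h : (i < n ∧ j ≤ i) ∨ (i = n ∧ j + 1 ≤ n)) :
    Improves n (sigmaRule i j) (sigmaRule i (j + 1)) (fun _ => n * (n + 1) + i)
      (sigmaPot n i j) := by
  have hn : 2 * (n : ℤ) ≤ n * (n + 1) := by nlinarith [show (1 : ℤ) ≤ n by omega]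
  have h1 := chain_one n i j
  have hlast := chain_add_nonpos (k := j + 1) j hi (show i ≤ n by omega) (by omega) (by omega)
  have hs := chain_succ (n := n) (i := i) hj le_rfl
  refine ⟨?_, ?_, ?_⟩
  · rintro (k | k) hk <;> simp at hk <;> simp only [sigmaRule] <;> split_ifs <;> simp <;> omega
  · rintro (k | k) hk <;> simp at hk <;> simp only [sigmaRule] <;> split_ifs <;>
      simp [IsEdge] <;> omega
  -- Values of `chain` are atoms for `omega`, so all comparisons between them are supplied
  -- beforehand.
  · rintro (k | k) hk (l | l) hl he <;> simp at hk hl <;> simp only [IsEdge] at he <;>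
      have hlmax := chain_le (j := j) (show i ≤ n by omega) l <;>
      have hgt := chain_of_lt (n := n) (i := i) (j := j) (k := l) <;>
      have hstep := chain_succ (n := n) (i := i) (j := j) (k := l) <;>
      have hgt' := chain_of_lt (n := n) (i := i) (j := j) (k := k) <;>
      have hpred := chain_pred (n := n) (i := i) (j := j) (k := k) <;>
      have hone := chain_mono (n := n) (i := i) (j := j) (k := 1) (l := k) (by omega) (by omega) <;>
      have hmono := chain_mono (n := n) (i := i) (j := j) (k := l) (l := k) (by omega) <;>
      have hmono' := chain_mono (n := n) (i := i) (j := j) (k := l + 1) (l := k) (by omega) <;>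
      have hmono'' := chain_mono (n := n) (i := i) (j := j) (k := l + 1) (l := j) (by omega) <;>
      simp only [sigmaRule] <;> split_ifs <;> simp [sigmaPot] <;>
      (try split_ifs) <;> omega

/-- The loop at `t_{i+1}` beats the edge to `b_{i+1}` by exactly 1: going round once and then to
`b_{i+1}` gains `(i+1-i) + (n+1-i)`. -/
lemma improves_sigma_tau {n i : ℕ} (hi : 1 ≤ i) (hin : i < n) :
    Improves n (sigmaRule i (i + 1)) (tauRule i) (fun _ => n * (n + 1) + i)
      (sigmaPot n i (i + 1)) := by
  have hn : 2 * (n : ℤ) ≤ n * (n + 1) := by nlinarith [show (1 : ℤ) ≤ n by omega]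
  have h1 := chain_one n i (i + 1)
  have hlast := chain_add_nonpos (k := i + 1 + 1) (i + 1) hi hin.le (by omega) (by omega)
  have hs := chain_succ (n := n) (i := i) (show 1 ≤ i + 1 by omega) le_rfl
  have heq : chain n i (i + 1) (i + 1 + 1) = chain n i (i + 1) (i + 2) := rfl
  refine ⟨?_, ?_, ?_⟩
  · rintro (k | k) hk <;> simp at hk <;> simp only [tauRule] <;> split_ifs <;> simp <;> omega
  · rintro (k | k) hk <;> simp at hk <;> simp only [tauRule] <;> split_ifs <;>
      simp [IsEdge] <;> omega
  · rintro (k | k) hk (l | l) hl he <;> simp at hk hl <;> simp only [IsEdge] at he <;>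
      have hlmax := chain_le (j := i + 1) (show i ≤ n by omega) l <;>
      have hgt := chain_of_lt (n := n) (i := i) (j := i + 1) (k := l) <;>
      have hstep := chain_succ (n := n) (i := i) (j := i + 1) (k := l) <;>
      have hgt' := chain_of_lt (n := n) (i := i) (j := i + 1) (k := k) <;>
      have hpred := chain_pred (n := n) (i := i) (j := i + 1) (k := k) <;>
      have hone := chain_mono (n := n) (i := i) (j := i + 1) (k := 1) (l := k) (by omega)
        (by omega) <;>
      have hmono := chain_mono (n := n) (i := i) (j := i + 1) (k := l) (l := k) (by omega) <;>
      have hmono' := chain_mono (n := n) (i := i) (j := i + 1) (k := l + 1) (l := k) (by omega) <;>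
      have hmono'' := chain_mono (n := n) (i := i) (j := i + 1) (k := l + 1) (l := i + 1)
        (by omega) <;>
      simp only [tauRule, sigmaRule] <;> split_ifs <;> simp [sigmaPot] <;>
      (try split_ifs) <;> (try omega) 
    -- Only the new loop itself ties with the new loop.
    obtain rfl : k = l := by omega
    simp

/-- Vertices with an edge to `t_{i+1}` are decided by value alone; potentials matter only for `t_k`
with `k ≤ i`. -/
lemma improves_tau {n i : ℕ} (hi : 1 ≤ i) (hin : i < n) :
    Improves n (tauRule i) (piRule (i + 1)) (tauVal n i) (tauPot n i) := by
  have hn : 2 * (n : ℤ) ≤ n * (n + 1) := by nlinarith [show (1 : ℤ) ≤ n by omega]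
  have h1 := chain_one n i (i + 2)
  have hlast := chain_add_nonpos (i + 2) hi hin.le hi (by omega)
  refine ⟨?_, ?_, ?_⟩
  · rintro (k | k) hk <;> simp at hk <;> simp only [piRule] <;> (try split_ifs) <;> simp <;> omega
  · rintro (k | k) hk <;> simp at hk <;> simp only [piRule] <;> (try split_ifs) <;>
      simp [IsEdge] <;> omega
  · rintro (k | k) hk (l | l) hl he <;> simp at hk hl <;> simp only [IsEdge] at he <;>
      have hpred := chain_pred (n := n) (i := i) (j := i + 2) (k := k) <;>
      have hmono := chain_mono (n := n) (i := i) (j := i + 2) (k := l) (l := k) (by omega) <;>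
      have hmono' := chain_mono (n := n) (i := i) (j := i + 2) (k := l + 1) (l := k) (by omega) <;>
      have hone := chain_mono (n := n) (i := i) (j := i + 2) (k := 1) (l := k) (by omega)
        (by omega) <;>
      have hmax := chain_mono (n := n) (i := i) (j := i + 2) (k := l) (l := i) (by omega) <;>
      simp only [piRule, tauRule] <;> split_ifs <;> simp [tauVal, tauPot] <;>
      (try split_ifs) <;> try omega
    all_goals
      -- Only `t_{i+1}` has the larger value.
      obtain rfl : l = i + 1 := by omega
      simp

end Label

/-! ### Number of vertices and edges, largest weight -/

namespace Label

lemma b_injective : Function.Injective b := fun _ _ h => by injection h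

lemma t_injective : Function.Injective t := fun _ _ h => by injection h

lemma disjoint_b_t (s : Finset ℕ) : Disjoint (s.image b) (s.image t) := by
  rw [Finset.disjoint_left]
  simp

lemma card_names (n : ℕ) : (names n).card = 2 * n := by
  rw [names, Finset.card_union_of_disjoint (disjoint_b_t _),
    Finset.card_image_of_injective _ b_injective, Finset.card_image_of_injective _ t_injective]
  simp
  ring

lemma card_filter_names (n : ℕ) (p : Label → Prop) [DecidablePred p] :
    ((names n).filter p).card = ((Finset.Icc 1 n).filter fun k => p (b k)).card +
      ((Finset.Icc 1 n).filter fun k => p (t k)).card := by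
  rw [names, Finset.filter_union, Finset.card_union_of_disjoint
    (Finset.disjoint_filter_filter (disjoint_b_t _)), Finset.filter_image, Finset.filter_image,
    Finset.card_image_of_injective _ b_injective, Finset.card_image_of_injective _ t_injective]

lemma sum_card_edges (n : ℕ) :
    2 * ∑ x ∈ names n, ((names n).filter (IsEdge x)).card = 5 * n ^ 2 + n := by
  have hb : ∀ i ∈ Finset.Icc 1 n, ((names n).filter (IsEdge (b i))).card = n + (i - 1) := by
    intro i hi
    rw [Finset.mem_Icc] at hi
    rw [card_filter_names, Finset.filter_true_of_mem (p := fun k => IsEdge (b i) (t k))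
      fun _ _ => trivial]
    simp only [IsEdge]
    rw [show (Finset.Icc 1 n).filter (fun k => k < i) = Finset.Icc 1 (i - 1) by
      ext k; simp only [Finset.mem_filter, Finset.mem_Icc]; omega, Nat.card_Icc, Nat.card_Icc]
    omega
  have ht : ∀ i ∈ Finset.Icc 1 n, ((names n).filter (IsEdge (t i))).card = 2 * i := by
    intro i hi
    rw [Finset.mem_Icc] at hi
    rw [card_filter_names]
    simp only [IsEdge]
    rw [show (Finset.Icc 1 n).filter (fun k => k ≤ i) = Finset.Icc 1 i by
      ext k; simp only [Finset.mem_filter, Finset.mem_Icc]; omega, Nat.card_Icc]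
    omega
  nth_rewrite 1 [names]
  rw [Finset.sum_union (disjoint_b_t _), Finset.sum_image b_injective.injOn,
    Finset.sum_image t_injective.injOn, Finset.sum_congr rfl hb, Finset.sum_congr rfl ht]
  -- The upper limit is separated from the `n` in the summand to allow induction.
  have : ∀ m : ℕ, 2 * (∑ i ∈ Finset.Icc 1 m, (n + (i - 1)) + ∑ i ∈ Finset.Icc 1 m, 2 * i) =
      2 * n * m + 3 * m ^ 2 + m := by
    intro m
    induction m with
    | zero => simp
    | succ m ih =>
      rw [Finset.sum_Icc_succ_top (by omega), Finset.sum_Icc_succ_top (by omega),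
        Nat.add_sub_cancel]
      linarith
  rw [this]
  ring

end Label

lemma card_vertex (n : ℕ) : Fintype.card (Vertex n) = 2 * n := by
  rw [Fintype.card_coe, Label.card_names]

lemma card_edges (n : ℕ) : 2 * (howardDMDP n).E.card = 5 * n ^ 2 + n := by
  rw [← Label.sum_card_edges]
  congr 1
  have : ∀ x : Vertex n, ((Label.names n).filter (Label.IsEdge x.1)).card =
      ((Finset.univ : Finset (Vertex n)).filter fun y => Label.IsEdge x.1 y.1).card := by
    intro x
    rw [← Finset.card_map (Function.Embedding.subtype _)]
    congr 1
    ext y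
    simp
    tauto
  rw [← Finset.sum_coe_sort]
  simp only [this]
  simp only [howardDMDP]
  rw [Finset.card_filter, ← Finset.univ_product_univ, Finset.sum_product]
  simp only [Finset.card_filter]

lemma natAbs_weight_le {n : ℕ} {e : Vertex n × Vertex n} :
    ((howardDMDP n).w e.1 e.2).natAbs ≤ (n + 1) ^ 2 := by
  obtain ⟨⟨x, hx⟩, ⟨y, hy⟩⟩ := e
  have h : |Label.weight n x y| ≤ (n + 1) ^ 2 := by
    have hpos : (0 : ℤ) ≤ n * (n + 1) := by positivity
    rw [show ((n : ℤ) + 1) ^ 2 = n * (n + 1) + (n + 1) by ring, abs_le]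
    rcases x with k | k <;> rcases y with l | l <;> simp at hx <;> simp <;>
      (try split_ifs) <;> omega
  rw [← Int.natCast_natAbs] at h
  change (Label.weight n x y).natAbs ≤ _
  exact_mod_cast h

lemma maxAbsWeight_eq {n : ℕ} (hn : 1 ≤ n) : (howardDMDP n).maxAbsWeight = (n + 1) ^ 2 := by
  refine le_antisymm (Finset.sup_le fun e _ => natAbs_weight_le) ?_
  let e : Vertex n × Vertex n := (⟨.t 1, by simpa⟩, ⟨.b 1, by simpa⟩)
  have he : e ∈ (howardDMDP n).E := 
    Finset.mem_filter.2 ⟨Finset.mem_univ _, le_refl 1⟩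
  refine le_trans (le_of_eq ?_) (Finset.le_sup (f := fun e => ((howardDMDP n).w e.1 e.2).natAbs) he)
  change _ = (((n : ℤ) + 1) ^ 2).natAbs
  rw [Int.natAbs_pow]
  rfl

lemma isEdge_of_policy {n : ℕ} (ρ : (howardDMDP n).Policy) (v : Vertex n) :
    Label.IsEdge v.1 (ρ.1 v).1 := by
  have := ρ.2 v
  simpa only [howardDMDP, Finset.mem_filter, Finset.mem_univ, true_and] using this

lemma Follows.congr {n : ℕ} {ρ : (howardDMDP n).Policy} {f f' : Label → Label} (h : Follows ρ f)
    (hf : ∀ x ∈ Label.names n, f x = f' x) : Follows ρ f' :=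
  fun v => (h v).trans (hf v.1 v.2)

lemma Follows.eq {n : ℕ} {ρ ρ' : (howardDMDP n).Policy} {f : Label → Label} (h : Follows ρ f)
    (h' : Follows ρ' f) : ρ = ρ' :=
  Subtype.ext (funext fun v => Subtype.ext ((h v).trans (h' v).symm))

lemma Follows.ne {n : ℕ} {ρ ρ' : (howardDMDP n).Policy} {f f' : Label → Label} (h : Follows ρ f)
    (h' : Follows ρ' f') {x : Label} (hx : x ∈ Label.names n) (hne : f' x ≠ f x) : ρ' ≠ ρ := by
  rintro rfl
  exact hne ((h' ⟨x, hx⟩).symm.trans (h ⟨x, hx⟩))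

/-! ### Initial policy and optimality -/

lemma follows_initialPolicy {n : ℕ} (hn : 1 ≤ n) :
    Follows (howardDMDP n).initialPolicy (Label.piRule 1) := by
  intro v
  have hmin : (howardDMDP n).initialPolicy.1 v = ⟨.t 1, by simpa⟩ := by
    refine le_antisymm (Finset.min'_le _ _ ?_) ?_
    · obtain ⟨x, hx⟩ := v
      refine Finset.mem_filter.2 ⟨Finset.mem_univ _, Finset.mem_filter.2 ⟨Finset.mem_univ _, ?_⟩⟩
      rcases x with k | k <;> simp at hx
      · trivial
      · exact hx.1
    · obtain ⟨y, hy⟩ := (howardDMDP n).initialPolicy.1 v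
      change (Label.t 1).key ≤ y.key
      rcases y with k | k <;> simp at hy
      · simp [Label.key, Prod.Lex.toLex_le_toLex]
      · simp only [Label.key, le_refl, if_true]
        split_ifs <;> simp [Prod.Lex.toLex_le_toLex]
        omega
  rw [hmin]
  obtain ⟨x, hx⟩ := v
  rcases x with k | k <;> simp at hx <;> simp [Label.piRule]
  omega

/-- The potential `b_k ↦ k`, `t_k ↦ k+1` drops by at least 1 along each heavy edge, offsetting its
excess over `n(n+1)+n`. Loops never exceed this bound. -/
lemma isOptimal_of_val {n : ℕ} {ρ : (howardDMDP n).Policy}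
    (hρ : ∀ v, ρ.val v = ((n * (n + 1) + n : ℤ) : ℝ)) : ρ.IsOptimal := by
  intro v
  refine ⟨⟨ρ, rfl⟩, ?_⟩
  rintro _ ⟨ρ', rfl⟩
  dsimp only
  rw [hρ v]
  let h : Label → ℤ := fun x => match x with
    | .b k => k
    | .t k => k + 1
  refine DMDP.limAvg_le_of_potential (fun v => (h v.1 : ℝ)) fun k => ?_
  have hrun : ρ'.run v (k + 1) = ρ'.1 (ρ'.run v k) := Function.iterate_succ_apply' _ _ _
  rw [hrun]
  have he := isEdge_of_policy ρ' (ρ'.run v k)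
  generalize ρ'.1 (ρ'.run v k) = y at he ⊢
  generalize ρ'.run v k = x at he ⊢
  obtain ⟨y, hy⟩ := y
  obtain ⟨x, hx⟩ := x
  change ((Label.weight n x y : ℤ) : ℝ) + (h y : ℝ) ≤ ((n * (n + 1) + n : ℤ) : ℝ) + (h x : ℝ)
  norm_cast
  push_cast
  have hpos : (n : ℤ) ≤ n * (n + 1) := by nlinarith
  rcases x with k | k <;> rcases y with l | l <;> simp at hx hy <;> simp only [Label.IsEdge] at he <;>
    simp [h] <;> (try split_ifs) <;> omega

/-! ### Counting the iterations -/

section Iterations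

open Label

variable {n : ℕ} {ρ : (howardDMDP n).Policy}

lemma Follows.bellman_pi {i : ℕ} (hi : 1 ≤ i) (hin : i ≤ n) (h : Follows ρ (piRule i)) :
    Follows ρ.bellman (sigmaRule i 1) :=
  h.bellman (evaluates_pi n i) (improves_pi hi hin)

lemma Follows.bellman_sigma {i j : ℕ} (hi : 1 ≤ i) (hj : 1 ≤ j)
    (hij : (i < n ∧ j ≤ i) ∨ (i = n ∧ j + 1 ≤ n)) (h : Follows ρ (sigmaRule i j)) :
    Follows ρ.bellman (sigmaRule i (j + 1)) :=
  h.bellman (evaluates_sigma hj (by omega)) (improves_sigma hi hj hij)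

lemma Follows.bellman_sigma_tau {i : ℕ} (hi : 1 ≤ i) (hin : i < n)
    (h : Follows ρ (sigmaRule i (i + 1))) : Follows ρ.bellman (tauRule i) :=
  h.bellman (evaluates_sigma (by omega) (by omega)) (improves_sigma_tau hi hin)

lemma Follows.bellman_tau {i : ℕ} (hi : 1 ≤ i) (hin : i < n) (h : Follows ρ (tauRule i)) :
    Follows ρ.bellman (piRule (i + 1)) :=
  h.bellman (evaluates_tau hi hin) (improves_tau hi hin)

lemma Follows.bellman_sigma_last (hn : 2 ≤ n) (h : Follows ρ (sigmaRule n (n - 1))) :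
    ρ.bellman = ρ := by
  have h' := h.bellman_sigma (by omega) (by omega) (Or.inr ⟨rfl, by omega⟩)
  rw [Nat.sub_add_cancel (by omega)] at h'
  refine h'.eq (h.congr ?_)
  rintro (k | k) hk <;> simp at hk <;> simp only [sigmaRule] <;> split_ifs <;> simp <;> omega

/-- Policy iteration started at `ρ` halts with an optimal policy after exactly `k` iterations. -/
def SolvedIn (ρ : (howardDMDP n).Policy) (k : ℕ) : Prop :=
  ∃ τ : (howardDMDP n).Policy, DMDP.Policy.HowardRun ρ k τ ∧ τ.IsOptimal

lemma SolvedIn.step {k : ℕ} (h : SolvedIn ρ.bellman k) (hne : ρ.bellman ≠ ρ) :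
    SolvedIn ρ (k + 1) := by
  obtain ⟨τ, h1, h2⟩ := h
  exact ⟨τ, .step ρ k τ hne h1, h2⟩

lemma Follows.solvedIn_sigma_last (m j : ℕ) (hm : j + m + 1 = n) (hj : 1 ≤ j)
    (h : Follows ρ (sigmaRule n j)) : SolvedIn ρ (m + 1) := by
  induction m generalizing j ρ with
  | zero =>
    obtain rfl : j = n - 1 := by omega
    exact ⟨ρ, .halt ρ (h.bellman_sigma_last (by omega)),
      isOptimal_of_val fun v => (h.val_pot (evaluates_sigma hj (by omega)) v).1⟩
  | succ m ih =>
    have h' := h.bellman_sigma (by omega) hj (Or.inr ⟨rfl, by omega⟩)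
    -- Here `j+2 ≤ n`, so `b_{j+2}` exists; it moves from `b_j` to `b_{j+1}`.
    refine (ih (j + 1) (by omega) (by omega) h').step (h.ne h' (x := .b (j + 2)) ?_ ?_)
    · simp; omega
    · simp [sigmaRule]

lemma Follows.solvedIn_sigma {i K : ℕ} (hi : 1 ≤ i) (hin : i < n)
    (hK : ∀ ρ : (howardDMDP n).Policy, Follows ρ (piRule (i + 1)) → SolvedIn ρ K)
    (m j : ℕ) (hm : j + m = i + 1) (hj : 1 ≤ j) (h : Follows ρ (sigmaRule i j)) :
    SolvedIn ρ (K + 2 + m) := by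
  induction m generalizing j ρ with
  | zero =>
    obtain rfl : j = i + 1 := by omega
    have h' := h.bellman_sigma_tau hi hin
    have h'' := h'.bellman_tau hi hin
    refine ((hK _ h'').step (h'.ne h'' (x := .b 1) ?_ ?_)).step (h.ne h' (x := .t (i + 1)) ?_ ?_)
    · simp; omega
    · simp [piRule, tauRule]
    · simp; omega
    · simp [sigmaRule, tauRule]
  | succ m ih =>
    have h' := h.bellman_sigma hi hj (Or.inl ⟨hin, by omega⟩)
    refine (ih (j + 1) (by omega) (by omega) h').step (h.ne h' (x := .t (i + 1)) ?_ ?_)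
    · simp; omega
    · simp only [sigmaRule]
      split_ifs <;> simp <;> omega

/-- The formula adds `i'+3` for each of the `m` phases `i' = i, …, n-1` to the `n` of the last
phase. -/
lemma Follows.solvedIn_pi (hn : 2 ≤ n) (m i : ℕ) (hm : i + m = n) (hi : 1 ≤ i) :
    ∃ K, 2 * K = 2 * n + m * (2 * i + m + 5) ∧
      ∀ ρ : (howardDMDP n).Policy, Follows ρ (piRule i) → SolvedIn ρ K := by
  have hne : ∀ i, 1 ≤ i → i ≤ n → ∀ ρ : (howardDMDP n).Policy, Follows ρ (piRule i) →
      ρ.bellman ≠ ρ := fun i hi hin ρ h =>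
    h.ne (h.bellman_pi hi hin) (x := .b 2) (by simpa) (by simp [piRule, sigmaRule])
  induction m generalizing i with
  | zero =>
    obtain rfl : i = n := by omega
    refine ⟨i, by ring, fun ρ h => ?_⟩
    have := ((h.bellman_pi hi le_rfl).solvedIn_sigma_last (i - 2) 1 (by omega) le_rfl).step
      (hne i hi le_rfl ρ h)
    rwa [show i - 2 + 1 + 1 = i by omega] at this
  | succ m ih =>
    obtain ⟨K, hK, hK'⟩ := ih (i + 1) (by omega) (by omega)
    exact ⟨K + 2 + i + 1, by linarith, fun ρ h =>
      ((h.bellman_pi hi (by omega)).solvedIn_sigma hi (by omega) hK' i 1 (by omega) le_rfl).step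
        (hne i hi (by omega) ρ h)⟩

lemma solvedIn_initialPolicy (hn : 1 ≤ n) :
    SolvedIn (howardDMDP n).initialPolicy ((n ^ 2 + 7 * n - 6) / 2) := by
  have h := follows_initialPolicy hn
  obtain rfl | hn2 : n = 1 ∨ 2 ≤ n := by omega
  -- On `P_1` the rules `π_1` and `σ_{1,1}` agree, so the first iteration already halts.
  · refine ⟨_, .halt _ ((h.bellman_pi le_rfl le_rfl).eq (h.congr ?_)),
      isOptimal_of_val fun v => (h.val_pot (evaluates_pi 1 1) v).1.trans ?_⟩
    · rintro (k | k) hk <;> simp at hk <;> obtain rfl : k = 1 := (by omega) <;> simp [piRule, sigmaRule]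
    · obtain ⟨x, hx⟩ := v
      rcases x with k | k <;> simp at hx <;> simp [piVal]
      omega
  · obtain ⟨K, hK, hK'⟩ := Follows.solvedIn_pi hn2 (n - 1) 1 (by omega) le_rfl
    obtain ⟨m, rfl⟩ := Nat.exists_eq_add_of_le' hn
    have : ((m + 1) ^ 2 + 7 * (m + 1) - 6) / 2 = K := by
      rw [Nat.add_sub_cancel] at hK
      have : (m + 1) ^ 2 + 7 * (m + 1) = 2 * K + 6 := by rw [hK]; ring
      omega
    rw [this]
    exact hK' _ h

end Iterations

/-! ### Asymptotics -/

lemma cast_iterations {n : ℕ} (hn : 1 ≤ n) :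
    (((n ^ 2 + 7 * n - 6) / 2 : ℕ) : ℚ) = ((n : ℚ) ^ 2 + 7 * n - 6) / 2 := by
  have h6 : 6 ≤ n ^ 2 + 7 * n := by nlinarith
  have h2 : 2 ∣ n ^ 2 + 7 * n - 6 := by
    rw [Nat.dvd_sub_iff_left h6 (by norm_num), ← even_iff_two_dvd]
    simp [parity_simps]
  rw [Nat.cast_div h2 (by norm_num), Nat.cast_sub h6]
  push_cast
  ring

lemma sq_le_two_mul_iterations {n : ℕ} (hn : 1 ≤ n) :
    (n : ℝ) ^ 2 ≤ 2 * ((n ^ 2 + 7 * n - 6) / 2 : ℕ) := by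
  have : n ^ 2 ≤ 2 * ((n ^ 2 + 7 * n - 6) / 2) := by omega
  exact_mod_cast this

lemma sq_le_size {n : ℕ} : n ^ 2 ≤ (howardDMDP n).size := by
  have := card_edges n
  have : (howardDMDP n).E.card ≤ (howardDMDP n).size := by unfold DMDP.size; omega
  nlinarith

/-- There are at most `3n²` edges, each contributing at most `2(⌊log₂ n⌋+1)`. As `log 2 > 1/2`,
`log₂ n ≤ 2 log n`; for `n ≥ 3`, `log n ≥ 1` absorbs the lower-order terms. -/
lemma size_le_mul_log {n : ℕ} (hn : 3 ≤ n) :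
    ((howardDMDP n).size : ℝ) ≤ 30 * ((n : ℝ) ^ 2 * Real.log n) := by
  have hclog : Nat.clog 2 ((n + 1) ^ 2) ≤ 2 * (Nat.log 2 n + 1) := by
    apply Nat.clog_le_of_le_pow
    rw [mul_comm, pow_mul]
    exact Nat.pow_le_pow_left (Nat.lt_pow_succ_log_self (by norm_num) n) 2
  have hsum : ∑ e ∈ (howardDMDP n).E, Nat.clog 2 ((howardDMDP n).w e.1 e.2).natAbs ≤
      (howardDMDP n).E.card * (2 * (Nat.log 2 n + 1)) := by
    rw [← smul_eq_mul]
    exact Finset.sum_le_card_nsmul _ _ _ fun e _ =>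
      (Nat.clog_mono_right 2 natAbs_weight_le).trans hclog
  have hE : (howardDMDP n).E.card ≤ 3 * n ^ 2 := by
    have := card_edges n
    nlinarith
  have hsize : (howardDMDP n).size ≤ 2 * n + 3 * n ^ 2 + 3 * n ^ 2 * (2 * (Nat.log 2 n + 1)) := by
    unfold DMDP.size
    rw [card_vertex]
    have := Nat.mul_le_mul_right (2 * (Nat.log 2 n + 1)) hE
    omega
  have hsize' : ((howardDMDP n).size : ℝ) ≤
      2 * n + 3 * (n : ℝ) ^ 2 + 3 * (n : ℝ) ^ 2 * (2 * ((Nat.log 2 n : ℕ) + 1)) := by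
    exact_mod_cast hsize
  have hn' : (3 : ℝ) ≤ n := by exact_mod_cast hn
  have hlog : 1 ≤ Real.log n := by
    rw [Real.le_log_iff_exp_le (by linarith)]
    linarith [Real.exp_one_lt_d9]
  have hnat : ((Nat.log 2 n : ℕ) : ℝ) ≤ 2 * Real.log n := by
    refine (Real.natLog_le_logb n 2).trans ?_
    rw [Real.logb, div_le_iff₀ (by exact_mod_cast Real.log_pos one_lt_two)]
    push_cast
    nlinarith [Real.log_two_gt_d9]
  have h1 := mul_le_mul_of_nonneg_left hnat (sq_nonneg (n : ℝ))
  have h2 := mul_le_mul_of_nonneg_left hlog (sq_nonneg (n : ℝ))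
  nlinarith

theorem theorem1 :
    ∃ N : ℕ → ℕ,
      -- the parameters of `P_n`, and the number of iterations on it
      (∀ n : ℕ, 1 ≤ n →
        Fintype.card (Vertex n) = 2 * n ∧
        ((howardDMDP n).E.card : ℚ) = (5 * (n : ℚ) ^ 2 + n) / 2 ∧
        (howardDMDP n).maxAbsWeight = (n + 1) ^ 2 ∧
        (N n : ℚ) = ((n : ℚ) ^ 2 + 7 * n - 6) / 2 ∧
        ∃ τ : (howardDMDP n).Policy,
          DMDP.Policy.HowardRun (howardDMDP n).initialPolicy (N n) τ ∧ τ.IsOptimal) ∧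
      -- the sequence of policies
      (∀ n : ℕ, 1 ≤ n →
        Follows (howardDMDP n).initialPolicy (Label.piRule 1) ∧
        (∀ (i : ℕ) (ρ : (howardDMDP n).Policy), 1 ≤ i → i ≤ n →
          Follows ρ (Label.piRule i) → Follows ρ.bellman (Label.sigmaRule i 1)) ∧
        (∀ (i j : ℕ) (ρ : (howardDMDP n).Policy), 1 ≤ i → 1 ≤ j →
          (i < n ∧ j ≤ i) ∨ (i = n ∧ j + 2 ≤ n) →
          Follows ρ (Label.sigmaRule i j) → Follows ρ.bellman (Label.sigmaRule i (j + 1))) ∧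
        (∀ (i : ℕ) (ρ : (howardDMDP n).Policy), 1 ≤ i → i < n →
          Follows ρ (Label.sigmaRule i (i + 1)) → Follows ρ.bellman (Label.tauRule i)) ∧
        (∀ (i : ℕ) (ρ : (howardDMDP n).Policy), 1 ≤ i → i < n →
          Follows ρ (Label.tauRule i) → Follows ρ.bellman (Label.piRule (i + 1))) ∧
        (∀ ρ : (howardDMDP n).Policy, 2 ≤ n →
          Follows ρ (Label.sigmaRule n (n - 1)) → ρ.bellman = ρ)) ∧
      -- size `O(n² log n)`, and number of iterations `Ω(n²)` and `Ω(I / log I)` in the size `I`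
      (fun n : ℕ => ((howardDMDP n).size : ℝ)) =O[atTop] (fun n : ℕ => (n : ℝ) ^ 2 * Real.log n) ∧
      (fun n : ℕ => (n : ℝ) ^ 2) =O[atTop] (fun n : ℕ => (N n : ℝ)) ∧
      (fun n : ℕ => ((howardDMDP n).size : ℝ) / Real.log ((howardDMDP n).size : ℝ))
        =O[atTop] (fun n : ℕ => (N n : ℝ)) := by
  refine ⟨fun n => (n ^ 2 + 7 * n - 6) / 2, fun n hn => ⟨card_vertex n, ?_, maxAbsWeight_eq hn,
    cast_iterations hn, solvedIn_initialPolicy hn⟩, fun n hn => ⟨follows_initialPolicy hn,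
    fun i ρ hi hin h => h.bellman_pi hi hin,
    fun i j ρ hi hj hij h => h.bellman_sigma hi hj (by omega),
    fun i ρ hi hin h => h.bellman_sigma_tau hi hin, fun i ρ hi hin h => h.bellman_tau hi hin,
    fun ρ hn2 h => h.bellman_sigma_last hn2⟩, ?_, ?_, ?_⟩
  · have : (2 * (howardDMDP n).E.card : ℚ) = 5 * (n : ℚ) ^ 2 + n := by
      exact_mod_cast card_edges n
    linarith
  · refine IsBigO.of_bound 30 ?_
    filter_upwards [eventually_ge_atTop 3] with n hn
    have := size_le_mul_log hn
    rw [Real.norm_of_nonneg (by positivity), Real.norm_of_nonneg (by positivity)]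
    exact this
  · refine IsBigO.of_bound 2 ?_
    filter_upwards [eventually_ge_atTop 1] with n hn
    rw [Real.norm_of_nonneg (by positivity), Real.norm_of_nonneg (by positivity)]
    exact sq_le_two_mul_iterations hn
  · refine IsBigO.of_bound 60 ?_
    filter_upwards [eventually_ge_atTop 3] with n hn
    have hlog : 0 < Real.log n := Real.log_pos (by exact_mod_cast (show 1 < n by omega))
    -- `n ≤ n² ≤ I` lets `log I` replace `log n` in `I ≤ 30 n² log n ≤ 60 N log n`.
    have hle : Real.log n ≤ Real.log ((howardDMDP n).size : ℝ) := by
      refine Real.log_le_log (by exact_mod_cast (show 0 < n by omega)) ?_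
      exact_mod_cast (Nat.le_self_pow two_ne_zero n).trans sq_le_size
    rw [Real.norm_of_nonneg (div_nonneg (by positivity) (hlog.le.trans hle)),
      Real.norm_of_nonneg (by positivity), div_le_iff₀ (hlog.trans_le hle)]
    have h1 := size_le_mul_log hn
    have h2 := sq_le_two_mul_iterations (show 1 ≤ n by omega)
    calc ((howardDMDP n).size : ℝ) ≤ 30 * ((n : ℝ) ^ 2 * Real.log n) := h1
      _ = 30 * (n : ℝ) ^ 2 * Real.log n := by ring
      _ ≤ 60 * ((n ^ 2 + 7 * n - 6) / 2 : ℕ) * Real.log n :=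
        mul_le_mul_of_nonneg_right (by linarith) hlog.le
      _ ≤ _ := mul_le_mul_of_nonneg_left hle (by positivity)
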